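/- Throughout, $q$ is a formal variable. Put $(q)_n=\prod_{j=1}^{n}(1-q^j)$ for integers $n\ge 0$. For $a,b\in\mathbb Z$ let ${a\brack b}_q=\frac{(q)_a}{(q)_b(q)_{a-b}}$ if $0\le b\le a$ and ${a\brack b}_q=0$ otherwise; this is a polynomial in $q$ with integer coefficients, and ${a\brack b}_{q^2}$ denotes the result of replacing $q$ by $q^2$ in it. Let $${L\choose m,n}_q={L\brack m}_q{L-m\brack n}_q .$$ For a polynomial $P$ in $q$, write $P(q)\ge 0$ if all its coefficients are non-negative. For $n_1,\dots,n_{v-1}\ge 0$ put $N_i=\sum_{j=i}^{v-1}n_j$. **Theorem.** Let $v,\Delta,L$ be integers with $v\ge 2$, $0\le\Delta<v$ and $L\ge 0$. Then $$\sum_{m,k,n_1,\dots,n_{v-1}\ge 0} q^{(m+k)^2+k^2+\Delta(m+2k)+\sum_{j=1}^{v-1}N_j^2+\sum_{t=v-\Delta}^{v-1}N_t}{L\choose m,2k+\Delta}_q{k-\sum_{t=1}^{v-2}N_t\brack n_{v-1}}_{q^2}\prod_{j=1}^{v-2}{n_j+2k-2\sum_{t=1}^{j}N_t+\min(\Delta,v-1-j)\brack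 n_j}_q$$ $$=\sum_{j=-\infty}^{\infty}(-1)^jq^{(2v+1)vj^2+(2v+1)\Delta j}{2L\brack L-\Delta-2vj}_q ,$$ where only finitely many terms on either side are non-zero. Moreover ${a\choose m,n}_q\ge 0$ for all integers $a,m,n$. Consequently $$G\Big(L-\Delta,\;L+\Delta,\;(v+\Delta)\big(1+\tfrac1{2v}\big),\;(v-\Delta)\big(1+\tfrac1{2v}\big),\;2v,\;q\Big)\ge 0,$$ where $$G(N,M,\alpha,\beta,K,q)=\sum_{j=-\infty}^{\infty}(-1)^jq^{Kj\frac{(\alpha+\beta)j+(\alpha-\beta)}{2}}{N+M\brack N-Kj}_q ;$$ in particular, this $G$ is a polynomial in $q$. -/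

import Mathlib

open Polynomial LaurentPolynomial

namespace QSeries

/-- The finite product `(q)_n = (1 - q)(1 - q ^ 2) ⋯ (1 - q ^ n)`, as a polynomial in `q = X`. -/
noncomputable def qPoch (n : ℕ) : ℤ[X] :=
  ∏ j ∈ Finset.range n, (1 - X ^ (j + 1))

/-- Gaussian polynomials, by the `q`-Pascal recurrence; `gaussBinom_mul_qPoch` below says that
`gaussBinom (n + m) n` is the quotient `(q)_{n+m} / ((q)_n (q)_m)`. -/
noncomputable def gaussBinom : ℕ → ℕ → ℤ[X]
  | _, 0 => 1
  | 0, _ + 1 => 0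
  | n + 1, k + 1 => gaussBinom n k + X ^ (k + 1) * gaussBinom n (k + 1)

theorem gaussBinom_eq_zero (n k : ℕ) (h : n < k) : gaussBinom n k = 0 := by
  induction n generalizing k with
  | zero =>
    obtain ⟨k, rfl⟩ : ∃ l, k = l + 1 := ⟨k - 1, by omega⟩
    simp [gaussBinom]
  | succ n ih =>
    obtain ⟨k, rfl⟩ : ∃ l, k = l + 1 := ⟨k - 1, by omega⟩
    simp [gaussBinom, ih k (by omega), ih (k + 1) (by omega)]

theorem qPoch_succ (n : ℕ) : qPoch (n + 1) = qPoch n * (1 - X ^ (n + 1)) :=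
  Finset.prod_range_succ _ _

theorem gaussBinom_self (n : ℕ) : gaussBinom n n = 1 := by
  induction n with
  | zero => simp [gaussBinom]
  | succ n ih => simp [gaussBinom, ih, gaussBinom_eq_zero n (n + 1) (by omega)]

theorem gaussBinom_mul_qPoch (n m : ℕ) :
    gaussBinom (n + m) n * (qPoch n * qPoch m) = qPoch (n + m) := by
  induction n generalizing m with
  | zero => simp [gaussBinom, qPoch]
  | succ n ihn =>
    induction m with
    | zero => simp [gaussBinom_self, qPoch]
    | succ m ihm =>
      have e : n + 1 + (m + 1) = (n + 1 + m) + 1 := by omega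
      have e' : n + (m + 1) = n + 1 + m := by omega
      have h1 := ihn (m + 1)
      rw [e', qPoch_succ m] at h1
      rw [qPoch_succ n] at ihm
      rw [e, gaussBinom, qPoch_succ n, qPoch_succ m, qPoch_succ (n + 1 + m)]
      linear_combination (1 - X ^ (n + 1)) * h1 + X ^ (n + 1) * (1 - X ^ (m + 1)) * ihm

/-- The `q`-binomial coefficient with integer entries `a` (top) and `b` (bottom):
it is `(q)_a / ((q)_b (q)_{a-b})` if `0 ≤ b ≤ a`, and `0` otherwise. -/
noncomputable def qBinom (a b : ℤ) : ℤ[X] :=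
  if 0 ≤ b ∧ b ≤ a then gaussBinom a.toNat b.toNat else 0

/-- The `q`-binomial coefficient in base `q ^ 2`. -/
noncomputable def qBinomSq (a b : ℤ) : ℤ[X] :=
  (qBinom a b).comp (X ^ 2)

/-- The `q`-trinomial coefficient `(L; m, n)_q = [L; m]_q [L - m; n]_q`. -/
noncomputable def qTrinom (L m n : ℤ) : ℤ[X] :=
  qBinom L m * qBinom (L - m) n

/-- `P(q) ≥ 0`: all coefficients of the polynomial `P` are non-negative. -/
def NonnegCoeffs (P : ℤ[X]) : Prop :=
  ∀ i, 0 ≤ P.coeff i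

/-- The entry `n_j` of `(n_1, …, n_r)`, with indices starting at `1`. -/
def entry {r : ℕ} (n : Fin r → ℕ) (j : ℕ) : ℕ :=
  if h : 1 ≤ j ∧ j ≤ r then n ⟨j - 1, by omega⟩ else 0

/-- `N_i = n_i + n_{i+1} + ⋯ + n_r`. -/
def tailSum {r : ℕ} (n : Fin r → ℕ) (i : ℕ) : ℕ :=
  ∑ j ∈ Finset.Icc i r, entry n j

/-- The summand with indices `m, k, n_1, …, n_{v-1}` of the multisum with parameters
`v`, `Δ` and `L`. -/
noncomputable def multisumTerm (v Δ L m k : ℕ) (n : Fin (v - 1) → ℕ) : ℤ[X] :=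
  X ^ ((m + k) ^ 2 + k ^ 2 + Δ * (m + 2 * k)
      + ∑ j ∈ Finset.Icc 1 (v - 1), tailSum n j ^ 2
      + ∑ t ∈ Finset.Icc (v - Δ) (v - 1), tailSum n t)
    * qTrinom L m (2 * k + Δ)
    * qBinomSq ((k : ℤ) - ∑ t ∈ Finset.Icc 1 (v - 2), (tailSum n t : ℤ)) (entry n (v - 1))
    * ∏ j ∈ Finset.Icc 1 (v - 2),
        qBinom ((entry n j : ℤ) + 2 * k - 2 * ∑ t ∈ Finset.Icc 1 j, (tailSum n t : ℤ)
          + min (Δ : ℤ) ((v : ℤ) - 1 - j)) (entry n j)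

/-- Finite integer combinations of rational powers `q ^ e`, `e ∈ ℚ`, of the variable `q`. -/
abbrev PuiseuxPoly : Type := AddMonoidAlgebra ℤ ℚ

/-- The power `q ^ e` with rational exponent `e`. -/
noncomputable def qPow (e : ℚ) : PuiseuxPoly := AddMonoidAlgebra.single e 1

/-- Polynomials in `q`, seen among the combinations of rational powers of `q`. -/
noncomputable def ofPoly : ℤ[X] →ₐ[ℤ] PuiseuxPoly := Polynomial.aeval (qPow 1)

/-- The `j`-th term of the series defining `G(N, M, α, β, K, q)`. -/
noncomputable def bressoudTerm (N M : ℤ) (α β : ℚ) (K : ℕ) (j : ℤ) : PuiseuxPoly :=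
  (j.negOnePow : ℤ) • (qPow ((K : ℚ) * j * (((α + β) * j + (α - β)) / 2))
    * ofPoly (qBinom (N + M) (N - K * j)))

/-- `G(N, M, α, β, K, q) = ∑_j (-1)^j q^{K j ((α + β) j + (α - β)) / 2} [N + M; N - K j]_q`, the
sum being over all integers `j`. It is finite as soon as `K ≠ 0`, see `bressoudTerm_finite`. -/
noncomputable def bressoudG (N M : ℤ) (α β : ℚ) (K : ℕ) : PuiseuxPoly :=
  ∑ᶠ j : ℤ, bressoudTerm N M α β K j

theorem qBinom_support_finite (N M : ℤ) (K : ℕ) (hK : K ≠ 0) :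
    {j : ℤ | qBinom (N + M) (N - K * j) ≠ 0}.Finite := by
  refine (Set.finite_Icc (-|M|) |N|).subset fun j hj => ?_
  have h : 0 ≤ N - K * j ∧ N - K * j ≤ N + M := by
    by_contra h
    exact hj (if_neg h)
  have hK' : (1 : ℤ) ≤ K := by exact_mod_cast Nat.one_le_iff_ne_zero.mpr hK
  have hN := le_abs_self N
  have hM := le_abs_self M
  have hN0 := abs_nonneg N
  have hM0 := abs_nonneg M
  constructor
  · by_contra hc
    nlinarith
  · by_contra hc
    nlinarith

theorem bressoudTerm_finite (N M : ℤ) (α β : ℚ) (K : ℕ) (hK : K ≠ 0) :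
    (Function.support (bressoudTerm N M α β K)).Finite := by
  refine (qBinom_support_finite N M K hK).subset fun j hj h => hj ?_
  simp [bressoudTerm, h]

end QSeries

open QSeries

/-!
The multisum is built from one seed identity by three summation formulas for `q`-binomial
coefficients, each of which acts on every term of an alternating sum separately.

* The seed writes `[L; i]_{q²}` as `∑_b (-1)^b q^{b²} [L; i - b] [L; i + b]`
  (`toLaurent_qBinomSq_eq_burgeSum`), the finite form of `(z; q)_L (-z; q)_L = (z²; q²)_L`.
* The Burge transform (`burge_transform`) multiplies by `q^{i² + ε i} [2 L + δ + M - i; M - i]` and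
  sums over `i`. By the `q`-Pfaff–Saalschütz sum (`gb_saalschutz`) it sends a product of two
  `q`-binomial coefficients to another such product, so that the alternating sums `burgeSum s t ε`
  are sent to one another. In terms of the chain `N_1 ≥ N_2 ≥ ⋯`, the factor with index `j`
  of the multisum is exactly the kernel of this transform, with `i = N_{j+1}` and `M = N_j`.
  The sums over `N_{v-1}, …, N_{v-Δ}` have `ε = 1`, the remaining ones `ε = 0`; the change is
  possible because the alternating sum has a second form (`burgeSum_one_eq_burgeSum_zero`).
* The summation over `N_1` is the limit `M → ∞` of the transform, a `q`-Vandermonde sum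
  (`burge_transform_limit`). It shows that the sum over `n_1, …, n_{v-1}` for fixed `k` is
  `∑_b (-1)^b q^{v b² + Δ b} [2 k + Δ; k - v b]` (`finsum_mul_chainWeight`).
* The sum over `m` and `k` against the `q`-trinomial coefficient turns each
  `[2 k + Δ; k - v b]` into a multiple of `[2 L; L - Δ - 2 v b]`, by two more `q`-Vandermonde sums
  (`gb_trinomial_transform`).

The terms of the multisum visibly have non-negative coefficients, and its alternating form is
`G` with the stated parameters. All computations take place in `ℤ[T;T⁻¹]`, so that exponents and
entries may be arbitrary integers; the exponents of the final sum are non-negative because `Δ < v`,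
which gives the identity between polynomials.
-/

namespace QSeries

/-! ### Gaussian binomials with integer entries -/

theorem qBinom_eq_zero {a b : ℤ} (h : ¬(0 ≤ b ∧ b ≤ a)) : qBinom a b = 0 := if_neg h

theorem qBinom_natCast (a b : ℕ) : qBinom a b = gaussBinom a b := by
  unfold qBinom
  split_ifs with h
  · simp
  · rw [gaussBinom_eq_zero]
    omega

theorem qPoch_ne_zero (n : ℕ) : qPoch n ≠ 0 := by
  refine Finset.prod_ne_zero_iff.mpr fun j _ h => ?_
  simpa using congrArg (Polynomial.eval 0) h

/-- The `q`-binomial coefficient with integer entries, as a Laurent polynomial in `q = T 1`. -/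
noncomputable def gb (a b : ℤ) : ℤ[T;T⁻¹] := toLaurent (qBinom a b)

theorem gb_eq_zero {a b : ℤ} (h : ¬(0 ≤ b ∧ b ≤ a)) : gb a b = 0 := by
  rw [gb, qBinom_eq_zero h, map_zero]

theorem gb_ne_zero {a b : ℤ} (h : gb a b ≠ 0) : 0 ≤ b ∧ b ≤ a := by
  by_contra hc
  exact h (gb_eq_zero hc)

theorem gb_zero_right {a : ℤ} (h : 0 ≤ a) : gb a 0 = 1 := by
  lift a to ℕ using h
  have := qBinom_natCast a 0
  rw [Nat.cast_zero] at this
  rw [gb, this]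
  cases a <;> simp [gaussBinom]

theorem gb_mul_qPoch (n m : ℕ) :
    gb (n + m) n * (toLaurent (qPoch n) * toLaurent (qPoch m)) = toLaurent (qPoch (n + m)) := by
  rw [gb, ← Nat.cast_add, qBinom_natCast, ← gaussBinom_mul_qPoch n m, map_mul, map_mul]

theorem toLaurent_qPoch_ne_zero (n : ℕ) : toLaurent (qPoch n) ≠ 0 := by
  rw [Ne, toLaurent_eq_zero]
  exact qPoch_ne_zero n

theorem gb_symm (a b : ℤ) : gb a (a - b) = gb a b := by
  by_cases h : 0 ≤ b ∧ b ≤ a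
  · obtain ⟨n, rfl⟩ := Int.eq_ofNat_of_zero_le h.1
    obtain ⟨m, hm⟩ := Int.eq_ofNat_of_zero_le (sub_nonneg.mpr h.2)
    obtain rfl : a = n + m := by omega
    rw [hm]
    have h1 := gb_mul_qPoch n m
    have h2 := gb_mul_qPoch m n
    rw [add_comm m n, add_comm (m : ℤ), mul_comm (toLaurent (qPoch m))] at h2
    refine mul_right_cancel₀ (mul_ne_zero (toLaurent_qPoch_ne_zero n)
      (toLaurent_qPoch_ne_zero m)) (h2.trans h1.symm)
  · rw [gb_eq_zero h, gb_eq_zero (by omega)]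

/-- For `b, c ≥ 0` and `b + c ≤ a`, both sides are the `q`-multinomial
coefficient `(q)_a / ((q)_b (q)_c (q)_{a-b-c})`. -/
theorem gb_mul_gb_sub_comm (a b c : ℤ) :
    gb a b * gb (a - b) c = gb a c * gb (a - c) b := by
  by_cases h : 0 ≤ b ∧ 0 ≤ c ∧ b + c ≤ a
  · obtain ⟨h1, h2, h3⟩ := h
    obtain ⟨l, hl⟩ := Int.eq_ofNat_of_zero_le (sub_nonneg.mpr h3)
    lift b to ℕ using h1
    lift c to ℕ using h2
    obtain rfl : a = b + c + l := by omega
    have e1 : (b : ℤ) + c + l - b = c + l := by ring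
    have e2 : (b : ℤ) + c + l - c = b + l := by ring
    have k1 := gb_mul_qPoch b (c + l)
    have k2 := gb_mul_qPoch c (b + l)
    have k3 := gb_mul_qPoch c l
    have k4 := gb_mul_qPoch b l
    rw [show c + (b + l) = b + (c + l) by ring] at k2
    push_cast at k1 k2
    rw [show (c : ℤ) + (b + l) = b + c + l by ring] at k2
    rw [show (b : ℤ) + (c + l) = b + c + l by ring] at k1
    rw [e1, e2]
    refine mul_right_cancel₀ (mul_ne_zero (mul_ne_zero (toLaurent_qPoch_ne_zero b)
      (toLaurent_qPoch_ne_zero c)) (toLaurent_qPoch_ne_zero l)) ?_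
    linear_combination k1 - k2 + gb (b + c + l) b * toLaurent (qPoch b) * k3
      - gb (b + c + l) c * toLaurent (qPoch c) * k4
  · rcases not_and_or.mp h with h | h
    · rw [gb_eq_zero (a := a) (b := b) (by omega), gb_eq_zero (a := a - c) (b := b) (by omega)]
      simp
    · rw [mul_eq_zero_of_ne_zero_imp_eq_zero fun h' => gb_eq_zero (by have := gb_ne_zero h'; omega),
        mul_eq_zero_of_ne_zero_imp_eq_zero fun h' => gb_eq_zero (by have := gb_ne_zero h'; omega)]

theorem gb_mul_gb (a b c : ℤ) : gb a b * gb b c = gb a c * gb (a - c) (b - c) := by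
  have := gb_mul_gb_sub_comm a (a - b) c
  rw [gb_symm, sub_sub_cancel] at this
  rw [this, ← gb_symm (a - c) (b - c)]
  ring_nf

/-- The `q`-Pascal recurrence. It would fail at `a = b = -1`. -/
theorem gb_succ {a : ℤ} (b : ℤ) (ha : 0 ≤ a) :
    gb (a + 1) (b + 1) = gb a b + T (b + 1) * gb a (b + 1) := by
  rcases lt_trichotomy b (-1) with hb | rfl | hb
  · rw [gb_eq_zero (by omega), gb_eq_zero (by omega), gb_eq_zero (by omega)]
    simp
  · simp only [neg_add_cancel]
    rw [gb_zero_right (by omega), gb_zero_right ha, gb_eq_zero (by omega)]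
    simp
  · lift a to ℕ using ha
    lift b to ℕ using (by omega)
    have h1 := qBinom_natCast (a + 1) (b + 1)
    have h2 := qBinom_natCast a (b + 1)
    push_cast at h1 h2
    rw [gb, gb, gb, h1, h2, qBinom_natCast, gaussBinom]
    simp [toLaurent_X_pow]

/-- The second `q`-Pascal recurrence, obtained from `gb_succ` by symmetry. -/
theorem gb_succ' {a : ℤ} (b : ℤ) (ha : 0 ≤ a) :
    gb (a + 1) (b + 1) = gb a (b + 1) + T (a - b) * gb a b := by
  have := gb_succ (a - b - 1) ha
  rw [show a - b - 1 + 1 = a + 1 - (b + 1) by ring, gb_symm,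
    show a - b - 1 = a - (b + 1) by ring, gb_symm, show a + 1 - (b + 1) = a - b by ring,
    gb_symm] at this
  exact this

/-! ### Finite sums over the integers -/

theorem finite_support_int {M : Type*} [Zero M] {f : ℤ → M} (A B : ℤ)
    (h : ∀ i, f i ≠ 0 → A ≤ i ∧ i ≤ B) : f.support.Finite :=
  (Set.finite_Icc A B).subset fun i hi => h i hi

theorem finsum_comm_int {M : Type*} [AddCommMonoid M] {f : ℤ → ℤ → M} (A B : ℤ)
    (h : ∀ i j, f i j ≠ 0 → (A ≤ i ∧ i ≤ B) ∧ A ≤ j ∧ j ≤ B) :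
    ∑ᶠ i, ∑ᶠ j, f i j = ∑ᶠ j, ∑ᶠ i, f i j := by
  have key : ∀ g : ℤ → ℤ → M, (∀ i j, g i j ≠ 0 → (A ≤ i ∧ i ≤ B) ∧ A ≤ j ∧ j ≤ B) →
      ∑ᶠ i, ∑ᶠ j, g i j = ∑ i ∈ Finset.Icc A B, ∑ j ∈ Finset.Icc A B, g i j := by
    intro g hg
    have h1 : ∀ i, ∑ᶠ j, g i j = ∑ j ∈ Finset.Icc A B, g i j := fun i =>
      finsum_eq_sum_of_support_subset _ fun j hj => by
        have := (hg i j hj).2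
        simpa using this
    simp only [h1]
    refine finsum_eq_sum_of_support_subset _ fun i hi => ?_
    obtain ⟨j, -, hj⟩ := Finset.exists_ne_zero_of_sum_ne_zero hi
    have := (hg i j hj).1
    simpa using this
  rw [key f h, key (fun j i => f i j) fun j i hj => (h i j hj).symm, Finset.sum_comm]

/-! ### The `q`-Vandermonde and `q`-Pfaff–Saalschütz sums -/

/-- The `q`-Vandermonde convolution. -/
theorem gb_vandermonde {X Y : ℤ} (hX : 0 ≤ X) (hY : 0 ≤ Y) (c : ℤ) :
    ∑ᶠ i : ℤ, T (i * (i + c)) * gb X i * gb Y (i + c) = gb (X + Y) (X + c) := by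
  lift X to ℕ using hX
  induction X generalizing c with
  | zero =>
    rw [finsum_eq_single _ 0]
    · simp [gb_zero_right]
    · intro i hi
      rw [gb_eq_zero (a := ((0 : ℕ) : ℤ)) (b := i) (by omega)]
      simp
  | succ X ih =>
    have hX : (0 : ℤ) ≤ X := by omega
    have h1 : ∀ i : ℤ, T (i * (i + c)) * gb ((X + 1 : ℕ) : ℤ) i * gb Y (i + c)
        = T (i * (i + c)) * gb X i * gb Y (i + c)
          + T (X + 1 + c) * (T ((i - 1) * ((i - 1) + (c + 1))) * gb X (i - 1)
            * gb Y ((i - 1) + (c + 1))) := by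
      intro i
      have := gb_succ' (i - 1) hX
      rw [sub_add_cancel] at this
      push_cast
      rw [this, show i - 1 + (c + 1) = i + c by ring,
        show i * (i + c) = (i - 1) * (i + c) + (i + c) by ring]
      have e : (T (X - (i - 1)) * T (i + c) : ℤ[T;T⁻¹]) = T (X + 1 + c) := by
        rw [← T_add]; congr 1; ring
      rw [← e, T_add]
      ring
    have fin : ∀ c : ℤ, (Function.support fun i : ℤ =>
        T (i * (i + c)) * gb X i * gb Y (i + c)).Finite := fun c =>
      finite_support_int 0 X fun i hi =>
        gb_ne_zero (right_ne_zero_of_mul (left_ne_zero_of_mul hi))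
    have sh := finsum_comp_equiv (Equiv.subRight (1 : ℤ))
      (f := fun i : ℤ => T (i * (i + (c + 1))) * gb X i * gb Y (i + (c + 1)))
    simp only [Equiv.subRight_apply] at sh
    simp only [h1]
    rw [finsum_add_distrib (fin c), ← mul_finsum, sh, ih c, ih (c + 1)]
    · push_cast
      have := gb_succ (X + c) (show 0 ≤ (X : ℤ) + Y by omega)
      rw [show (X : ℤ) + 1 + Y = X + Y + 1 by ring, show (X : ℤ) + 1 + c = X + c + 1 by ring,
        this, show (X : ℤ) + (c + 1) = X + c + 1 by ring]
    · exact finite_support_int 1 (X + 1) fun i hi => by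
        have := gb_ne_zero (right_ne_zero_of_mul (left_ne_zero_of_mul (right_ne_zero_of_mul hi)))
        omega

/-- The `q`-Vandermonde convolution, with lower entries of constant sum. -/
theorem gb_vandermonde' {A B : ℤ} (hA : 0 ≤ A) (hB : 0 ≤ B) (n : ℤ) :
    ∑ᶠ j : ℤ, T (j * (B - n + j)) * gb A j * gb B (n - j) = gb (A + B) n := by
  rw [← gb_symm (A + B) n, show A + B - n = A + (B - n) by ring, ← gb_vandermonde hA hB]
  refine finsum_congr fun j => ?_
  rw [← gb_symm B (n - j), show B - (n - j) = j + (B - n) by ring, add_comm (B - n) j]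

/-- The `q`-Vandermonde convolution when one of the two tops may be negative: the conditions on the
sign of `c` make both sides vanish in that case. -/
theorem gb_vandermonde_of_sign {X Y c : ℤ} (hX : 0 ≤ X ∨ c ≤ 0) (hY : 0 ≤ Y ∨ 0 ≤ c) :
    ∑ᶠ i : ℤ, T (i * (i + c)) * gb X i * gb Y (i + c) = gb (X + Y) (X + c) := by
  by_cases hX0 : 0 ≤ X
  · by_cases hY0 : 0 ≤ Y
    · exact gb_vandermonde hX0 hY0 c
    · rw [gb_eq_zero (by omega)]
      refine finsum_eq_zero_of_forall_eq_zero fun i => ?_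
      rw [gb_eq_zero (a := Y) (by omega), mul_zero]
  · rw [gb_eq_zero (by omega)]
    refine finsum_eq_zero_of_forall_eq_zero fun i => ?_
    rw [gb_eq_zero (a := X) (by omega), mul_zero, zero_mul]

theorem gb_saalschutz_of_nonneg {X Y m : ℤ} (hX : 0 ≤ X) (hY : 0 ≤ Y) (hm : 0 ≤ m) (c : ℤ) :
    ∑ᶠ i : ℤ, T (i * (i + c)) * gb (X + Y + m - i) (X + Y) * gb X i * gb Y (i + c)
      = gb (m + c + X) m * gb (m + Y) (m + c) := by
  -- Expand the first binomial by the `q`-Vandermonde convolution and sum over `i` first.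
  have h1 : ∀ i : ℤ, T (i * (i + c)) * gb (X + Y + m - i) (X + Y) * gb X i * gb Y (i + c)
      = ∑ᶠ j : ℤ, (T (j * (m - X + j)) * gb X j * gb (Y + m) (X + Y - j)) *
          (T (i * (i + c)) * gb (X - j) i * gb Y (i + c)) := by
    intro i
    by_cases hi : 0 ≤ i ∧ i ≤ X
    · have := gb_vandermonde' (A := X - i) (B := Y + m) (by omega) (by omega) (X + Y)
      rw [show X - i + (Y + m) = X + Y + m - i by ring] at this
      rw [← this, mul_finsum, finsum_mul, finsum_mul]
      refine finsum_congr fun j => ?_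
      rw [show Y + m - (X + Y) + j = m - X + j by ring]
      linear_combination T (j * (m - X + j)) * gb (Y + m) (X + Y - j) * T (i * (i + c))
        * gb Y (i + c) * gb_mul_gb_sub_comm X i j
    · rw [gb_eq_zero hi, mul_zero, zero_mul, eq_comm]
      refine finsum_eq_zero_of_forall_eq_zero fun j => ?_
      have := gb_mul_gb_sub_comm X i j
      rw [gb_eq_zero hi, zero_mul] at this
      linear_combination - T (j * (m - X + j)) * gb (Y + m) (X + Y - j) * T (i * (i + c))
        * gb Y (i + c) * this
  have h2 : ∀ j : ℤ, ∑ᶠ i : ℤ, (T (j * (m - X + j)) * gb X j * gb (Y + m) (X + Y - j)) *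
          (T (i * (i + c)) * gb (X - j) i * gb Y (i + c))
      = gb (Y + m) (Y - c) * (T (j * (m - X + j)) * gb X j * gb (m + c) (X + c - j)) := by
    intro j
    rw [← mul_finsum]
    by_cases hj : 0 ≤ j ∧ j ≤ X
    · rw [gb_vandermonde (by omega) hY c, ← gb_symm (X - j + Y)]
      have := gb_mul_gb (Y + m) (X + Y - j) (Y - c)
      rw [show Y + m - (Y - c) = m + c by ring,
        show X + Y - j - (Y - c) = X + c - j by ring] at this
      rw [show X - j + Y - (X - j + c) = Y - c by ring, show X - j + Y = X + Y - j by ring]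
      linear_combination T (j * (m - X + j)) * gb X j * this
    · rw [gb_eq_zero hj]
      simp
  simp only [h1]
  rw [finsum_comm_int 0 X]
  · simp only [h2]
    rw [← mul_finsum]
    by_cases hc : 0 ≤ m + c
    · have := gb_vandermonde' hX hc (X + c)
      rw [show m + c - (X + c) = m - X by ring] at this
      rw [this, ← gb_symm (Y + m), ← gb_symm (X + (m + c)), mul_comm,
        show X + (m + c) - (X + c) = m by ring, show Y + m - (Y - c) = m + c by ring,
        add_comm X, add_comm Y]
    · rw [gb_eq_zero (a := Y + m) (by omega), gb_eq_zero (a := m + Y) (by omega)]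
      simp
  · intro i j h
    have h1 := gb_ne_zero (right_ne_zero_of_mul (left_ne_zero_of_mul (left_ne_zero_of_mul h)))
    have h2 := gb_ne_zero (right_ne_zero_of_mul (left_ne_zero_of_mul (right_ne_zero_of_mul h)))
    omega

/-- The `q`-Pfaff–Saalschütz sum. The conditions on the sign of `c` exclude that the right-hand side
is non-zero although `X` or `Y` is negative. -/
theorem gb_saalschutz {X Y m c : ℤ} (hX : 0 ≤ X ∨ c ≤ 0) (hY : 0 ≤ Y ∨ 0 ≤ c) :
    ∑ᶠ i : ℤ, T (i * (i + c)) * gb (X + Y + m - i) (X + Y) * gb X i * gb Y (i + c)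
      = gb (m + c + X) m * gb (m + Y) (m + c) := by
  by_cases h : 0 ≤ X ∧ 0 ≤ Y ∧ 0 ≤ m
  · exact gb_saalschutz_of_nonneg h.1 h.2.1 h.2.2 c
  · have hr : gb (m + c + X) m * gb (m + Y) (m + c) = 0 := by
      by_contra hne
      have h1 := gb_ne_zero (left_ne_zero_of_mul hne)
      have h2 := gb_ne_zero (right_ne_zero_of_mul hne)
      omega
    rw [hr]
    refine finsum_eq_zero_of_forall_eq_zero fun i => ?_
    by_contra hne
    have h1 := gb_ne_zero (right_ne_zero_of_mul hne)
    have h2 := gb_ne_zero (right_ne_zero_of_mul (left_ne_zero_of_mul hne))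
    have h3 := gb_ne_zero (right_ne_zero_of_mul (left_ne_zero_of_mul (left_ne_zero_of_mul hne)))
    omega

/-! ### The transformation by `q`-trinomial coefficients -/

/-- Multiplying a Gaussian binomial by a `q`-trinomial coefficient and summing gives a Gaussian
binomial again. The proof applies the `q`-Vandermonde convolution to `[2 L; L - r]`, with summation
index `u = m + p`, and then to the factor `[L; u + r]` with `L = u + (L - u)`. -/
theorem gb_trinomial_transform {L : ℤ} (hL : 0 ≤ L) (r : ℤ) :
    ∑ᶠ m : ℤ, ∑ᶠ p : ℤ, T (m ^ 2 + m * (2 * p + r) + 2 * p * (p + r)) *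
        (gb L m * gb (L - m) (2 * p + r)) * gb (2 * p + r) p
      = gb (2 * L) (L - r) := by
  have h1 : ∀ u : ℤ, T (u * (u + r)) * gb L u * gb L (u + r)
      = ∑ᶠ p : ℤ, T (u * (u + r) + p * (p + r)) * gb L u * gb u p * gb (L - u) (p + r) := by
    intro u
    by_cases hu : 0 ≤ u ∧ u ≤ L
    · have := gb_vandermonde hu.1 (sub_nonneg.mpr hu.2) r
      rw [show u + (L - u) = L by ring] at this
      rw [← this, mul_finsum]
      refine finsum_congr fun p => ?_
      rw [T_add]
      ring
    · simp [gb_eq_zero hu]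
  have h2 : ∀ p m : ℤ, T ((m + p) * ((m + p) + r) + p * (p + r)) * gb L (m + p) * gb (m + p) p
        * gb (L - (m + p)) (p + r)
      = T (m ^ 2 + m * (2 * p + r) + 2 * p * (p + r)) *
        (gb L m * gb (L - m) (2 * p + r)) * gb (2 * p + r) p := by
    intro p m
    have k1 := gb_mul_gb (L - m) (2 * p + r) p
    have k2 := gb_mul_gb L (m + p) p
    have k3 := gb_mul_gb_sub_comm L m p
    rw [show 2 * p + r - p = p + r by ring, sub_sub] at k1
    rw [add_sub_cancel_right] at k2
    rw [show (m + p) * ((m + p) + r) + p * (p + r)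
      = m ^ 2 + m * (2 * p + r) + 2 * p * (p + r) by ring]
    linear_combination T (m ^ 2 + m * (2 * p + r) + 2 * p * (p + r)) *
      (gb (L - (m + p)) (p + r) * (k2 - k3) - gb L m * k1)
  have h3 : ∀ p : ℤ, ∑ᶠ u : ℤ, T (u * (u + r) + p * (p + r)) * gb L u * gb u p
        * gb (L - u) (p + r)
      = ∑ᶠ m : ℤ, T (m ^ 2 + m * (2 * p + r) + 2 * p * (p + r)) *
        (gb L m * gb (L - m) (2 * p + r)) * gb (2 * p + r) p := by
    intro p
    rw [← finsum_comp_equiv (Equiv.addRight p)]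
    simp only [Equiv.coe_addRight, h2]
  have h4 := gb_vandermonde hL hL r
  rw [← gb_symm (2 * L), show 2 * L - (L - r) = L + r by ring, show 2 * L = L + L by ring, ← h4,
    eq_comm]
  simp only [h1]
  rw [finsum_comm_int 0 L]
  · simp only [h3]
    refine finsum_comm_int (-L) L fun p m h => ?_
    have h1 := gb_ne_zero (left_ne_zero_of_mul (right_ne_zero_of_mul (left_ne_zero_of_mul h)))
    have h2 := gb_ne_zero (right_ne_zero_of_mul (right_ne_zero_of_mul (left_ne_zero_of_mul h)))
    have h3 := gb_ne_zero (right_ne_zero_of_mul h)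
    omega
  · intro u p h
    have h2 := gb_ne_zero (right_ne_zero_of_mul (left_ne_zero_of_mul h))
    have h3 := gb_ne_zero (right_ne_zero_of_mul (left_ne_zero_of_mul (left_ne_zero_of_mul h)))
    omega

/-! ### Alternating sums of products of two Gaussian binomials -/

/-- The sign `(-1) ^ j` for an integer `j`, as a Laurent polynomial. -/
noncomputable def altSign (j : ℤ) : ℤ[T;T⁻¹] := ((j.negOnePow : ℤ) : ℤ[T;T⁻¹])

theorem altSign_add (i j : ℤ) : altSign (i + j) = altSign i * altSign j := by
  simp [altSign, Int.negOnePow_add]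

theorem altSign_one : altSign 1 = -1 := by simp [altSign]

theorem altSign_neg (j : ℤ) : altSign (-j) = altSign j := by simp [altSign]

theorem altSign_sub_one_neg (j : ℤ) : altSign (1 - j) = -altSign j := by
  rw [sub_eq_add_neg, altSign_add, altSign_one, altSign_neg, neg_one_mul]

theorem altSign_neg_one_sub (j : ℤ) : altSign (-1 - j) = -altSign j := by
  rw [← altSign_neg, show -(-1 - j) = j + 1 by ring, altSign_add, altSign_one, mul_neg_one]

theorem finsum_eq_zero_of_antisymm {f : ℤ → ℤ[T;T⁻¹]} (c : ℤ) (h : ∀ j, f (c - j) = -f j) :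
    ∑ᶠ j, f j = 0 := by
  have h1 := finsum_comp_equiv (Equiv.subLeft c) (f := f)
  simp only [Equiv.subLeft_apply, h, finsum_neg_distrib] at h1
  have h2 : (2 : ℤ[T;T⁻¹]) * ∑ᶠ j, f j = 0 := by linear_combination -h1
  have h3 : (2 : ℤ[T;T⁻¹]) ≠ 0 := by
    rw [← map_ofNat (toLaurent (R := ℤ)) 2, Ne, toLaurent_eq_zero]
    exact two_ne_zero
  exact (mul_eq_zero.mp h2).resolve_left h3

/-- The `b`-th term of the alternating sum that represents the partial multisums. The parameters
`s` and `t` count the Burge transforms applied with linear exponent `i` and `0` respectively;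
`ε` is added to both entries of the second Gaussian binomial. -/
noncomputable def burgeTerm (s t ε L i b : ℤ) : ℤ[T;T⁻¹] :=
  altSign b * T (b ^ 2 + s * (b ^ 2 + b) + t * b ^ 2) * gb (L + s * (b + 1) + t * b) (i - b)
    * gb (L + ε - s * b - t * b) (i + b + ε)

/-- The alternating sum over all integers `b` of `burgeTerm s t ε L i b`. -/
noncomputable def burgeSum (s t ε L i : ℤ) : ℤ[T;T⁻¹] :=
  ∑ᶠ b : ℤ, burgeTerm s t ε L i b

/-- The bound `i ≤ L` matters: it makes the range `0 ≤ i ≤ L` forced on the multisum by its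
`q`-binomial coefficients agree with unrestricted summation over `i`. -/
theorem burgeTerm_ne_zero {s t ε L i b : ℤ} (hs : 0 ≤ s) (ht : 0 ≤ t)
    (h : burgeTerm s t ε L i b ≠ 0) : b ≤ i ∧ -b ≤ i + ε ∧ i ≤ L := by
  have h1 := gb_ne_zero (right_ne_zero_of_mul h)
  have h2 := gb_ne_zero (right_ne_zero_of_mul (left_ne_zero_of_mul h))
  refine ⟨by omega, by omega, ?_⟩
  rcases le_or_gt 0 b with hb | hb
  · nlinarith [mul_nonneg hs hb, mul_nonneg ht hb]
  · nlinarith [mul_nonneg hs (by omega : 0 ≤ -(b + 1)), mul_nonneg ht (by omega : 0 ≤ -b)]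

theorem burgeTerm_support_finite (s t ε L i : ℤ) :
    (Function.support (burgeTerm s t ε L i)).Finite :=
  finite_support_int (-(i + ε)) i fun b h => by
    have h1 := gb_ne_zero (right_ne_zero_of_mul h)
    have h2 := gb_ne_zero (right_ne_zero_of_mul (left_ne_zero_of_mul h))
    omega

theorem burgeSum_eq_zero {s t ε L i : ℤ} (hs : 0 ≤ s) (ht : 0 ≤ t) (hi : L < i) :
    burgeSum s t ε L i = 0 :=
  finsum_eq_zero_of_forall_eq_zero fun b => by
    by_contra h
    have := burgeTerm_ne_zero hs ht h
    omega

/-- By the `q`-Pascal recurrence for the second factor, the terms on the two sides differ by a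
function of `b` that is antisymmetric under `b ↦ -1 - b`. -/
theorem burgeSum_one_eq_burgeSum_zero {s L i : ℤ} (hs : 0 ≤ s) (hL : 0 ≤ L) :
    burgeSum s 0 1 L i = burgeSum s 0 0 L i := by
  set D : ℤ → ℤ[T;T⁻¹] := fun b => altSign b * T (b ^ 2 + s * (b ^ 2 + b) + (i + b + 1))
    * gb (L + s * (b + 1)) (i - b) * gb (L - s * b) (i + b + 1) with hD
  have hstep : ∀ b, burgeTerm s 0 1 L i b = burgeTerm s 0 0 L i b + D b := by
    intro b
    simp only [burgeTerm, hD, zero_mul, add_zero, sub_zero]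
    by_cases hb : 0 ≤ L - s * b
    · have := gb_succ (i + b) hb
      rw [show L + 1 - s * b = L - s * b + 1 by ring, this, T_add _ (i + b + 1)]
      ring
    · -- Here the top `L - s * b` is negative, so `b > 0`; for `b ≤ i` even `L + 1 - s * b`
      -- is smaller than `i + b + 1`.
      have hb' : 0 < b := by
        by_contra hc
        nlinarith [mul_nonneg hs (by omega : 0 ≤ -b)]
      by_cases hi : 0 ≤ i - b
      · rw [gb_eq_zero (a := L + 1 - s * b) (by omega), gb_eq_zero (a := L - s * b) (by omega),
          gb_eq_zero (a := L - s * b) (by omega)]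
        simp
      · rw [gb_eq_zero (b := i - b) (by omega)]
        simp
  have hzero : ∑ᶠ b, D b = 0 := by
    refine finsum_eq_zero_of_antisymm (-1) fun b => ?_
    simp only [hD, altSign_neg_one_sub]
    rw [show (-1 - b) ^ 2 + s * ((-1 - b) ^ 2 + (-1 - b)) + (i + (-1 - b) + 1)
        = b ^ 2 + s * (b ^ 2 + b) + (i + b + 1) by ring,
      show L + s * (-1 - b + 1) = L - s * b by ring, show i - (-1 - b) = i + b + 1 by ring,
      show L - s * (-1 - b) = L + s * (b + 1) by ring, show i + (-1 - b) + 1 = i - b by ring]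
    ring
  rw [burgeSum, burgeSum, finsum_congr hstep,
    finsum_add_distrib (burgeTerm_support_finite s 0 0 L i), hzero, add_zero]
  refine finite_support_int (-(i + 1)) i fun b h => ?_
  have h1 := gb_ne_zero (right_ne_zero_of_mul h)
  have h2 := gb_ne_zero (right_ne_zero_of_mul (left_ne_zero_of_mul h))
  omega

/-! ### The seed in base `q ^ 2` -/

theorem toLaurent_qBinomSq_zero_right {a : ℤ} (ha : 0 ≤ a) : toLaurent (qBinomSq a 0) = 1 := by
  have : qBinom a 0 = 1 := toLaurent_injective (by simpa [gb] using gb_zero_right ha)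
  simp [qBinomSq, this]

theorem toLaurent_qBinomSq_succ {a : ℤ} (b : ℤ) (ha : 0 ≤ a) :
    toLaurent (qBinomSq (a + 1) (b + 1))
      = toLaurent (qBinomSq a b) + T (2 * (b + 1)) * toLaurent (qBinomSq a (b + 1)) := by
  rcases lt_trichotomy b (-1) with hb | rfl | hb
  · simp only [qBinomSq]
    rw [qBinom_eq_zero (by omega), qBinom_eq_zero (by omega), qBinom_eq_zero (by omega)]
    simp
  · simp only [neg_add_cancel]
    rw [toLaurent_qBinomSq_zero_right (by omega), toLaurent_qBinomSq_zero_right ha, qBinomSq,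
      qBinom_eq_zero (by omega)]
    simp
  · lift a to ℕ using ha
    lift b to ℕ using (by omega)
    have h1 := qBinom_natCast (a + 1) (b + 1)
    have h2 := qBinom_natCast a (b + 1)
    push_cast at h1 h2
    rw [qBinomSq, qBinomSq, qBinomSq, h1, h2, qBinom_natCast, gaussBinom]
    simp only [add_comp, mul_comp, pow_comp, X_comp, map_add, map_mul, ← pow_mul,
      toLaurent_X_pow]
    push_cast
    ring

/-- The `z ^ (2 * i)`-coefficient of `(z; q)_L (-z; q)_L = (z²; q²)_L`. The right-hand side
satisfies the `q²`-Pascal recurrence, by the `q`-Pascal recurrence for both factors and an antisymmetry under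
`b ↦ 1 - b`. -/
theorem toLaurent_qBinomSq_eq_burgeSum {L : ℤ} (hL : 0 ≤ L) (i : ℤ) :
    toLaurent (qBinomSq L i) = burgeSum 0 0 0 L i := by
  lift L to ℕ using hL
  induction L generalizing i with
  | zero =>
    by_cases hi : i = 0
    · subst hi
      rw [toLaurent_qBinomSq_zero_right (by omega), burgeSum, finsum_eq_single _ 0]
      · simp [burgeTerm, altSign, gb_zero_right]
      · intro b hb
        by_contra h
        have := burgeTerm_ne_zero le_rfl le_rfl h
        omega
    · rw [qBinomSq, qBinom_eq_zero (by omega), zero_comp, map_zero, burgeSum, eq_comm]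
      refine finsum_eq_zero_of_forall_eq_zero fun b => ?_
      by_contra h
      have := burgeTerm_ne_zero le_rfl le_rfl h
      omega
  | succ L ih =>
    have hL : (0 : ℤ) ≤ L := by omega
    set D : ℤ → ℤ[T;T⁻¹] := fun b => altSign b * T (b ^ 2 - b + i) * gb L (i - b)
      * gb L (i + b - 1) with hD
    have hstep : ∀ b, burgeTerm 0 0 0 ((L + 1 : ℕ) : ℤ) i b
        = burgeTerm 0 0 1 L (i - 1) b + (T (2 * i) * burgeTerm 0 0 0 L i b + D b) := by
      intro b
      simp only [burgeTerm, hD, zero_mul, add_zero, sub_zero]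
      have h1 := gb_succ (i - b - 1) hL
      have h2 := gb_succ (i + b - 1) hL
      rw [sub_add_cancel] at h1 h2
      push_cast
      rw [show i - 1 - b = i - b - 1 by ring, show i - 1 + b + 1 = i + b by ring, h1, h2]
      have e1 : (T (b ^ 2 - b + i) : ℤ[T;T⁻¹]) = T (b ^ 2) * T (i - b) := by
        rw [← T_add]; congr 1; ring
      have e2 : (T (2 * i) : ℤ[T;T⁻¹]) = T (i - b) * T (i + b) := by
        rw [← T_add]; congr 1; ring
      rw [e1, e2]
      ring
    have hzero : ∑ᶠ b, D b = 0 := by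
      refine finsum_eq_zero_of_antisymm 1 fun b => ?_
      simp only [hD, altSign_sub_one_neg]
      rw [show (1 - b) ^ 2 - (1 - b) + i = b ^ 2 - b + i by ring,
        show i - (1 - b) = i + b - 1 by ring, show i + (1 - b) - 1 = i - b by ring]
      ring
    have finD : (Function.support D).Finite := by
      refine finite_support_int (-(i + 1)) (i + 1) fun b h => ?_
      have h1 := gb_ne_zero (right_ne_zero_of_mul h)
      have h2 := gb_ne_zero (right_ne_zero_of_mul (left_ne_zero_of_mul h))
      omega
    have fin0 : (Function.support fun b => T (2 * i) * burgeTerm 0 0 0 L i b).Finite :=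
      (burgeTerm_support_finite 0 0 0 L i).subset fun b hb => right_ne_zero_of_mul hb
    have hp := toLaurent_qBinomSq_succ (i - 1) hL
    rw [sub_add_cancel] at hp
    rw [burgeSum, finsum_congr hstep, finsum_add_distrib (burgeTerm_support_finite _ _ _ _ _),
      finsum_add_distrib fin0 finD, hzero, add_zero, ← mul_finsum]
    · change _ = burgeSum 0 0 1 L (i - 1) + T (2 * i) * burgeSum 0 0 0 L i
      rw [burgeSum_one_eq_burgeSum_zero le_rfl hL, ← ih, ← ih]
      push_cast
      exact hp
    · refine (fin0.union finD).subset fun b hb => ?_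
      by_contra hc
      simp only [Set.mem_union, Function.mem_support, not_or, not_not] at hc
      exact hb (by simp only [hc.1, hc.2, add_zero])

/-! ### The Burge transform -/

/-- Sums over `i` of a weight against `burgeSum` can be carried out for each `b` separately. -/
theorem finsum_mul_burgeSum {s t ε L : ℤ} (hs : 0 ≤ s) (ht : 0 ≤ t) (w : ℤ → ℤ[T;T⁻¹]) :
    ∑ᶠ i : ℤ, w i * burgeSum s t ε L i = ∑ᶠ b : ℤ, ∑ᶠ i : ℤ, w i * burgeTerm s t ε L i b := by
  simp only [burgeSum, mul_finsum]
  refine finsum_comm_int (-(|L| + |ε|)) (|L| + |ε|) fun i b h => ?_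
  have h1 := burgeTerm_ne_zero hs ht (right_ne_zero_of_mul h)
  have := abs_nonneg L
  have := abs_nonneg ε
  have := le_abs_self L
  have := le_abs_self ε
  omega

/-- The Burge transform: it keeps the form of the alternating sum, and raises `s` by one
if `ε = 1`, and `t` by one if `ε = 0`. -/
theorem burge_transform {s t ε L : ℤ} (hs : 0 ≤ s) (ht : 0 ≤ t) (hε : ε = 0 ∨ ε = 1) (hL : 0 ≤ L)
    (M : ℤ) :
    ∑ᶠ i : ℤ, T (i ^ 2 + ε * i) * gb (2 * L + s + ε + M - i) (M - i) * burgeSum s t ε L i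
      = burgeSum (s + ε) (t + 1 - ε) ε (L + M) M := by
  rw [finsum_mul_burgeSum hs ht, burgeSum]
  refine finsum_congr fun b => ?_
  -- For `b ≥ 0` the top `X` below is non-negative and `c ≥ 0`; for `b < 0` the top `Y` is
  -- non-negative and `c ≤ 0`. These are the sign conditions of the summation formula.
  have hsb : 0 ≤ b ∧ 0 ≤ s * b ∧ 0 ≤ t * b ∨ b ≤ -1 ∧ s * (b + 1) ≤ 0 ∧ s * b ≤ 0 ∧ t * b ≤ 0 := by
    rcases le_or_gt 0 b with hb | hb
    · exact Or.inl ⟨hb, mul_nonneg hs hb, mul_nonneg ht hb⟩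
    · exact Or.inr ⟨by omega, mul_nonpos_of_nonneg_of_nonpos hs (by omega),
        mul_nonpos_of_nonneg_of_nonpos hs (by omega), mul_nonpos_of_nonneg_of_nonpos ht (by omega)⟩
  have hsb' : s * (b + 1) = s * b + s := by ring
  have key := gb_saalschutz (X := L + s * (b + 1) + t * b) (Y := L + ε - s * b - t * b)
    (m := M - b) (c := 2 * b + ε) (by omega) (by omega)
  rw [← finsum_comp_equiv (Equiv.addRight b)]
  simp only [Equiv.coe_addRight]
  have hterm : ∀ i : ℤ, T ((i + b) ^ 2 + ε * (i + b)) *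
        gb (2 * L + s + ε + M - (i + b)) (M - (i + b)) * burgeTerm s t ε L (i + b) b
      = altSign b * T (b ^ 2 + (s + ε) * (b ^ 2 + b) + (t + 1 - ε) * b ^ 2) *
        (T (i * (i + (2 * b + ε)))
          * gb (L + s * (b + 1) + t * b + (L + ε - s * b - t * b) + (M - b) - i)
            (L + s * (b + 1) + t * b + (L + ε - s * b - t * b))
          * gb (L + s * (b + 1) + t * b) i
          * gb (L + ε - s * b - t * b) (i + (2 * b + ε))) := by
    intro i
    have e : (T ((i + b) ^ 2 + ε * (i + b)) * T (b ^ 2 + s * (b ^ 2 + b) + t * b ^ 2) : ℤ[T;T⁻¹])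
        = T (b ^ 2 + (s + ε) * (b ^ 2 + b) + (t + 1 - ε) * b ^ 2)
          * T (i * (i + (2 * b + ε))) := by
      rw [← T_add, ← T_add]; congr 1; ring
    have g := gb_symm (L + s * (b + 1) + t * b + (L + ε - s * b - t * b) + (M - b) - i)
            (L + s * (b + 1) + t * b + (L + ε - s * b - t * b))
    rw [← g, show L + s * (b + 1) + t * b + (L + ε - s * b - t * b) + (M - b) - i
      - (L + s * (b + 1) + t * b + (L + ε - s * b - t * b)) = M - (i + b) by ring,
      show L + s * (b + 1) + t * b + (L + ε - s * b - t * b) + (M - b) - i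
        = 2 * L + s + ε + M - (i + b) by ring, burgeTerm,
      show i + b - b = i by ring, show i + b + b + ε = i + (2 * b + ε) by ring]
    linear_combination altSign b * gb (2 * L + s + ε + M - (i + b)) (M - (i + b))
      * gb (L + s * (b + 1) + t * b) i * gb (L + ε - s * b - t * b) (i + (2 * b + ε)) * e
  rw [finsum_congr hterm, ← mul_finsum, key, burgeTerm,
    show M - b + (2 * b + ε) + (L + s * (b + 1) + t * b)
      = L + M + (s + ε) * (b + 1) + (t + 1 - ε) * b by ring,
    show M - b + (L + ε - s * b - t * b) = L + M + ε - (s + ε) * b - (t + 1 - ε) * b by ring,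
    show M - b + (2 * b + ε) = M + b + ε by ring]
  ring

/-- The limit `M → ∞` of the Burge transform, which closes the chain. -/
theorem burge_transform_limit {s t ε L : ℤ} (hs : 0 ≤ s) (ht : 0 ≤ t) (hε : ε = 0 ∨ ε = 1)
    (hL : 0 ≤ L) :
    ∑ᶠ i : ℤ, T (i ^ 2 + ε * i) * burgeSum s t ε L i
      = ∑ᶠ b : ℤ, altSign b * T ((s + t + 2) * b ^ 2 + (s + ε) * b)
        * gb (2 * L + s + ε) (L - (s + t + 2) * b) := by
  rw [finsum_mul_burgeSum hs ht]
  refine finsum_congr fun b => ?_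
  -- For `b ≥ 0` the top `X` below is non-negative and `c ≥ 0`; for `b < 0` the top `Y` is
  -- non-negative and `c ≤ 0`. These are the sign conditions of the summation formula.
  have hsb : 0 ≤ b ∧ 0 ≤ s * b ∧ 0 ≤ t * b ∨ b ≤ -1 ∧ s * (b + 1) ≤ 0 ∧ s * b ≤ 0 ∧ t * b ≤ 0 := by
    rcases le_or_gt 0 b with hb | hb
    · exact Or.inl ⟨hb, mul_nonneg hs hb, mul_nonneg ht hb⟩
    · exact Or.inr ⟨by omega, mul_nonpos_of_nonneg_of_nonpos hs (by omega),
        mul_nonpos_of_nonneg_of_nonpos hs (by omega), mul_nonpos_of_nonneg_of_nonpos ht (by omega)⟩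
  have hsb' : s * (b + 1) = s * b + s := by ring
  have key := gb_vandermonde_of_sign (X := L + s * (b + 1) + t * b) (Y := L + ε - s * b - t * b)
    (c := 2 * b + ε) (by omega) (by omega)
  rw [← gb_symm, show L + s * (b + 1) + t * b + (L + ε - s * b - t * b)
      - (L + s * (b + 1) + t * b + (2 * b + ε)) = L - (s + t + 2) * b by ring,
    show L + s * (b + 1) + t * b + (L + ε - s * b - t * b) = 2 * L + s + ε by ring] at key
  rw [← finsum_comp_equiv (Equiv.addRight b)]
  simp only [Equiv.coe_addRight]
  have hterm : ∀ i : ℤ, T ((i + b) ^ 2 + ε * (i + b)) * burgeTerm s t ε L (i + b) b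
      = altSign b * T ((s + t + 2) * b ^ 2 + (s + ε) * b) *
        (T (i * (i + (2 * b + ε))) * gb (L + s * (b + 1) + t * b) i
          * gb (L + ε - s * b - t * b) (i + (2 * b + ε))) := by
    intro i
    have e : (T ((i + b) ^ 2 + ε * (i + b)) * T (b ^ 2 + s * (b ^ 2 + b) + t * b ^ 2) : ℤ[T;T⁻¹])
        = T ((s + t + 2) * b ^ 2 + (s + ε) * b) * T (i * (i + (2 * b + ε))) := by
      rw [← T_add, ← T_add]; congr 1; ring
    rw [burgeTerm, show i + b - b = i by ring, show i + b + b + ε = i + (2 * b + ε) by ring]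
    linear_combination altSign b
      * gb (L + s * (b + 1) + t * b) i * gb (L + ε - s * b - t * b) (i + (2 * b + ε)) * e
  rw [finsum_congr hterm, ← mul_finsum, key]

/-! ### Chains and iterated Burge transforms -/

theorem finsum_natCast {M : Type*} [AddCommMonoid M] {f : ℤ → M} (h : ∀ i < 0, f i = 0) :
    ∑ᶠ n : ℕ, f n = ∑ᶠ i, f i := by
  rw [← finsum_mem_range (f := f) Nat.cast_injective, finsum_mem_def, Set.indicator_eq_self.mpr]
  intro i hi
  have : 0 ≤ i := by
    by_contra hc
    exact hi (h i (by omega))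
  exact ⟨i.toNat, by omega⟩

/-- The part of the multisum that comes after `f 0`: a weight on chains `f 0 ≥ f 1 ≥ ⋯ ≥ f p`,
built so that summation over `f 1` is a Burge transform. The chain `f i` stands for `N_{i+j}`, where
`j + p` is the largest index of the multisum. -/
noncomputable def chainWeight (Δ : ℕ) : ℕ → ℤ → (ℕ → ℕ) → ℤ[T;T⁻¹]
  | 0, L, f => toLaurent (qBinomSq L (f 0))
  | p + 1, L, f => T ((f 1 : ℤ) ^ 2 + (if p < Δ then 1 else 0) * f 1)
      * gb (2 * (L - f 0) + min (Δ : ℤ) (p + 1) + f 0 - f 1) (f 0 - f 1)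
      * chainWeight Δ p (L - f 0) fun i => f (i + 1)

theorem qBinomSq_ne_zero {a b : ℤ} (h : qBinomSq a b ≠ 0) : 0 ≤ b ∧ b ≤ a := by
  by_contra hc
  exact h (by rw [qBinomSq, qBinom_eq_zero hc, zero_comp])

theorem chainWeight_ne_zero {Δ p : ℕ} {L : ℤ} {f : ℕ → ℕ} (h : chainWeight Δ p L f ≠ 0) :
    (∀ i ≤ p, (f i : ℤ) ≤ L) ∧ ∀ i < p, f (i + 1) ≤ f i := by
  induction p generalizing L f with
  | zero =>
    rw [chainWeight, Ne, toLaurent_eq_zero] at h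
    refine ⟨fun i hi => ?_, by omega⟩
    obtain rfl : i = 0 := by omega
    exact (qBinomSq_ne_zero h).2
  | succ p ih =>
    rw [chainWeight] at h
    obtain ⟨h1, h2⟩ := ih (right_ne_zero_of_mul h)
    have h3 := gb_ne_zero (right_ne_zero_of_mul (left_ne_zero_of_mul h))
    constructor
    · rintro (_ | i) hi
      · have := h1 0 (by omega)
        omega
      · have := h1 i (by omega)
        omega
    · rintro (_ | i) hi
      · simp only [zero_add]
        omega
      · exact h2 i (by omega)

/-- The sequence with values `g 0, …, g (p - 1)`, continued by zeros. -/
def extendZero {p : ℕ} (g : Fin p → ℕ) (i : ℕ) : ℕ :=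
  if h : i < p then g ⟨i, h⟩ else 0

/-- The sequence `M, g 0, …, g (p - 1), 0, 0, …`. -/
def prependTo {p : ℕ} (M : ℕ) (g : Fin p → ℕ) : ℕ → ℕ
  | 0 => M
  | i + 1 => extendZero g i

theorem extendZero_cons {p : ℕ} (M : ℕ) (g : Fin p → ℕ) :
    extendZero (Fin.cons M g : Fin (p + 1) → ℕ) = prependTo M g := by
  funext i
  rcases i with _ | i
  · simp [extendZero, prependTo]
  · by_cases h : i < p
    · simp only [extendZero, prependTo, h, Nat.add_lt_add_iff_right, dite_true]
      exact Fin.cons_succ (α := fun _ => ℕ) M g ⟨i, h⟩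
    · simp [extendZero, prependTo, h]

theorem finite_setOf_le {p : ℕ} (L : ℕ) : {g : Fin p → ℕ | ∀ i, g i ≤ L}.Finite :=
  (Set.finite_Icc (0 : Fin p → ℕ) fun _ => L).subset fun _ hg => ⟨fun _ => Nat.zero_le _, hg⟩

theorem extendZero_chainWeight_support_finite {Δ p : ℕ} (L : ℤ)
    {F : (Fin (p + 1) → ℕ) → ℤ[T;T⁻¹]}
    (h : ∀ g, F g ≠ 0 → chainWeight Δ p L (extendZero g) ≠ 0) :
    (Function.support F).Finite := by
  refine (finite_setOf_le L.toNat).subset fun g hg i => ?_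
  have := (chainWeight_ne_zero (h g hg)).1 i (by omega)
  simp only [extendZero, i.isLt, dite_true, Fin.eta] at this
  omega

theorem finsum_cons {p : ℕ} {F : (Fin (p + 1) → ℕ) → ℤ[T;T⁻¹]} (hF : (Function.support F).Finite) :
    ∑ᶠ g, F g = ∑ᶠ (i : ℕ) (g : Fin p → ℕ), F (Fin.cons i g) := by
  rw [← finsum_comp_equiv (Fin.consEquiv fun _ : Fin (p + 1) => ℕ), finsum_curry]
  · rfl
  · exact hF.preimage (Equiv.injective _).injOn

theorem burgeSum_of_neg {s t ε L i : ℤ} (hε : ε = 0 ∨ ε = 1) (hi : i < 0) :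
    burgeSum s t ε L i = 0 :=
  finsum_eq_zero_of_forall_eq_zero fun b => by
    by_contra h
    have h1 := gb_ne_zero (right_ne_zero_of_mul h)
    have h2 := gb_ne_zero (right_ne_zero_of_mul (left_ne_zero_of_mul h))
    omega

/-- Iterated Burge transforms: the first `Δ` of them have linear exponent `i`, after which the
alternating sum is rewritten by `burgeSum_one_eq_burgeSum_zero`. -/
theorem finsum_chainWeight (Δ p : ℕ) {L : ℤ} (hL : 0 ≤ L) (M : ℕ) :
    ∑ᶠ g : Fin p → ℕ, chainWeight Δ p L (prependTo M g)
      = burgeSum (min p Δ : ℕ) (p - Δ : ℕ) (if p < Δ then 1 else 0) L M := by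
  induction p generalizing L M with
  | zero =>
    rw [finsum_eq_single _ default (fun g hg => (hg (Subsingleton.elim _ _)).elim)]
    simp only [chainWeight, prependTo, toLaurent_qBinomSq_eq_burgeSum hL, Nat.zero_min,
      Nat.zero_sub, Nat.cast_zero]
    split_ifs
    · exact (burgeSum_one_eq_burgeSum_zero le_rfl hL).symm
    · rfl
  | succ p ih =>
    rw [finsum_cons]
    · have hstep : ∀ (i : ℕ) (g : Fin p → ℕ),
          chainWeight Δ (p + 1) L (prependTo M (Fin.cons i g : Fin (p + 1) → ℕ))
          = T ((i : ℤ) ^ 2 + (if p < Δ then 1 else 0) * i)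
            * gb (2 * (L - M) + min (Δ : ℤ) (p + 1) + M - i) (M - i)
            * chainWeight Δ p (L - M) (prependTo i g) := by
        intro i g
        have e : (fun j => prependTo M (Fin.cons i g : Fin (p + 1) → ℕ) (j + 1))
            = prependTo i g := extendZero_cons i g
        have e1 := congrFun e 0
        simp only [zero_add] at e1
        rw [chainWeight, e, e1]
        rfl
      simp only [hstep, ← mul_finsum]
      rcases lt_or_ge L M with hLM | hLM
      · rw [burgeSum_eq_zero (by omega) (by omega) hLM]
        refine finsum_eq_zero_of_forall_eq_zero fun i => ?_
        rw [finsum_eq_zero_of_forall_eq_zero, mul_zero]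
        intro g
        by_contra h
        have := (chainWeight_ne_zero h).1 0 (by omega)
        omega
      · simp only [ih (sub_nonneg.mpr hLM)]
        have hε : (if p < Δ then (1 : ℤ) else 0) = 0 ∨ (if p < Δ then (1 : ℤ) else 0) = 1 := by
          split_ifs <;> simp
        have key := burge_transform (s := (min p Δ : ℕ)) (t := (p - Δ : ℕ)) (by omega) (by omega)
          hε (sub_nonneg.mpr hLM) (M : ℤ)
        rw [← finsum_natCast] at key
        · rw [sub_add_cancel] at key
          have e : (2 * (L - M) + min (Δ : ℤ) (p + 1) : ℤ)
              = 2 * (L - M) + (min p Δ : ℕ) + if p < Δ then 1 else 0 := by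
            split_ifs <;> omega
          rw [e, key]
          -- At `p + 1 = Δ` the linear exponents end and the sum is rewritten with `ε = 0`.
          rcases lt_trichotomy (p + 1) Δ with h | h | h
          · rw [if_pos (by omega), if_pos h]
            congr 1 <;> omega
          · rw [if_pos (by omega), if_neg (by omega), show (((p - Δ : ℕ) : ℤ) + 1 - 1) = 0 by omega,
              show ((p + 1 - Δ : ℕ) : ℤ) = 0 by omega,
              burgeSum_one_eq_burgeSum_zero (by omega) hL]
            congr 1
            omega
          · rw [if_neg (by omega), if_neg (by omega)]
            congr 1 <;> omega
        · intro i hi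
          rw [burgeSum_of_neg hε hi, mul_zero]
    · refine (finite_setOf_le L.toNat).subset fun g hg i => ?_
      have := (chainWeight_ne_zero hg).1 (i + 1) (by omega)
      simp only [prependTo, extendZero, i.isLt, dite_true, Fin.eta] at this
      omega

/-- The doubly bounded form of Bressoud's identity for even moduli. -/
theorem finsum_mul_chainWeight {Δ p k : ℕ} (hΔ : Δ < p + 2) :
    ∑ᶠ g : Fin (p + 1) → ℕ, T ((extendZero g 0 : ℤ) ^ 2
        + (if p < Δ then 1 else 0) * (extendZero g 0 : ℤ)) * chainWeight Δ p k (extendZero g)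
      = ∑ᶠ b : ℤ, altSign b * T ((p + 2) * b ^ 2 + Δ * b)
        * gb (2 * k + Δ) (k - (p + 2) * b) := by
  rw [finsum_cons (extendZero_chainWeight_support_finite k fun g => right_ne_zero_of_mul)]
  have hε : (if p < Δ then (1 : ℤ) else 0) = 0 ∨ (if p < Δ then (1 : ℤ) else 0) = 1 := by
    split_ifs <;> simp
  have hk : (0 : ℤ) ≤ k := by omega
  have key := burge_transform_limit (s := (min p Δ : ℕ)) (t := (p - Δ : ℕ)) (by omega) (by omega)
    hε hk
  rw [← finsum_natCast] at key
  · have e1 : ((min p Δ : ℕ) : ℤ) + (if p < Δ then (1 : ℤ) else 0) = Δ := by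
      split_ifs <;> omega
    have e2 : ((min p Δ : ℕ) : ℤ) + (p - Δ : ℕ) = p := by omega
    rw [add_assoc (2 * (k : ℤ)), e1, e2] at key
    rw [← key]
    simp only [extendZero_cons]
    refine finsum_congr fun i => ?_
    rw [← finsum_chainWeight Δ p hk, mul_finsum]
    rfl
  · intro i hi
    rw [burgeSum_of_neg hε hi, mul_zero]

/-! ### The multisum as a sum over chains -/

/-- The recursively defined weight as an explicit product. The condition `p < Δ + (i + 1)` says that
the transform that sums over `f (i + 1)` has linear exponent. -/
theorem chainWeight_eq (Δ p : ℕ) (L : ℤ) (f : ℕ → ℕ) :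
    chainWeight Δ p L f
      = T (∑ i ∈ Finset.range p, (f (i + 1) : ℤ) ^ 2
          + ∑ i ∈ Finset.range p, if p < Δ + (i + 1) then (f (i + 1) : ℤ) else 0)
        * toLaurent (qBinomSq (L - ∑ i ∈ Finset.range p, (f i : ℤ)) (f p))
        * ∏ i ∈ Finset.range p,
            gb (2 * (L - ∑ t ∈ Finset.range (i + 1), (f t : ℤ)) + min (Δ : ℤ) (p - i)
              + f i - f (i + 1)) (f i - f (i + 1)) := by
  induction p generalizing L f with
  | zero => simp [chainWeight]
  | succ p ih =>
    rw [chainWeight, ih, Finset.sum_range_succ' (fun i => (f (i + 1) : ℤ) ^ 2),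
      Finset.sum_range_succ' (fun i => if p + 1 < Δ + (i + 1) then (f (i + 1) : ℤ) else 0),
      Finset.sum_range_succ' (fun i => (f i : ℤ)), Finset.prod_range_succ']
    have e1 : (T ((f 1 : ℤ) ^ 2 + (if p < Δ then 1 else 0) * (f 1 : ℤ)) : ℤ[T;T⁻¹])
          * T (∑ i ∈ Finset.range p, (f (i + 1 + 1) : ℤ) ^ 2
            + ∑ i ∈ Finset.range p, if p < Δ + (i + 1) then (f (i + 1 + 1) : ℤ) else 0)
        = T (∑ i ∈ Finset.range p, (f (i + 1 + 1) : ℤ) ^ 2 + (f (0 + 1) : ℤ) ^ 2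
            + (∑ i ∈ Finset.range p,
                (if p + 1 < Δ + (i + 1 + 1) then (f (i + 1 + 1) : ℤ) else 0)
              + if p + 1 < Δ + (0 + 1) then (f (0 + 1) : ℤ) else 0)) := by
      rw [← T_add]
      congr 1
      simp only [zero_add, add_lt_add_iff_right, ← add_assoc, ite_mul, one_mul, zero_mul]
      ring
    have e2 : ∀ i : ℕ, gb (2 * (L - f 0 - ∑ t ∈ Finset.range (i + 1), (f (t + 1) : ℤ))
          + min (Δ : ℤ) (p - i) + f (i + 1) - f (i + 1 + 1)) (f (i + 1) - f (i + 1 + 1))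
        = gb (2 * (L - ∑ t ∈ Finset.range (i + 1 + 1), (f t : ℤ))
          + min (Δ : ℤ) ((p + 1 : ℕ) - (i + 1 : ℕ)) + f (i + 1) - f (i + 1 + 1))
            (f (i + 1) - f (i + 1 + 1)) := by
      intro i
      rw [Finset.sum_range_succ' (fun t => (f t : ℤ))]
      congr 2
      push_cast
      rw [add_sub_add_right_eq_sub]
      ring
    rw [← e1]
    simp only [e2]
    rw [show L - (∑ i ∈ Finset.range p, (f (i + 1) : ℤ) + f 0)
      = L - f 0 - ∑ i ∈ Finset.range p, (f (i + 1) : ℤ) by ring]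
    simp only [zero_add, Finset.sum_range_one, Nat.cast_zero, sub_zero, Nat.cast_add, Nat.cast_one]
    ring

theorem prod_Icc_one_eq_prod_range {M : Type*} [CommMonoid M] (n : ℕ) (g : ℕ → M) :
    ∏ j ∈ Finset.Icc 1 n, g j = ∏ i ∈ Finset.range n, g (i + 1) := by
  rw [Finset.range_eq_Ico, Finset.prod_Ico_add' g 0 n 1]
  rfl

theorem sum_Icc_one_eq_sum_range {M : Type*} [AddCommMonoid M] (n : ℕ) (g : ℕ → M) :
    ∑ j ∈ Finset.Icc 1 n, g j = ∑ i ∈ Finset.range n, g (i + 1) := by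
  rw [Finset.range_eq_Ico, Finset.sum_Ico_add' g 0 n 1]
  rfl

theorem tailSum_eq_entry_add {r : ℕ} (n : Fin r → ℕ) {j : ℕ} (hj : j ≤ r) :
    tailSum n j = entry n j + tailSum n (j + 1) := by
  rw [tailSum, tailSum, ← Finset.insert_Icc_succ_left_eq_Icc hj, Finset.sum_insert (by simp)]
  rfl

theorem tailSum_of_lt {r : ℕ} (n : Fin r → ℕ) {j : ℕ} (hj : r < j) : tailSum n j = 0 := by
  rw [tailSum, Finset.Icc_eq_empty (by omega), Finset.sum_empty]

/-- The summand of the multisum with `v = p + 2`, in terms of the chain `N_1 ≥ ⋯ ≥ N_{p+1}`: the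
factor for `j` depends on `n_j` and `k` only through `N_j`, `N_{j+1}` and `k - N_1 - ⋯ - N_j`. -/
theorem toLaurent_multisumTerm {p Δ : ℕ} (hΔ : Δ < p + 2) (L m k : ℕ) (n : Fin (p + 1) → ℕ) :
    toLaurent (multisumTerm (p + 2) Δ L m k n)
      = T (((m : ℤ) + k) ^ 2 + k ^ 2 + Δ * (m + 2 * k)) * (gb L m * gb (L - m) (2 * k + Δ))
        * (T ((tailSum n 1 : ℤ) ^ 2 + (if p < Δ then 1 else 0) * (tailSum n 1 : ℤ))
          * chainWeight Δ p k fun i => tailSum n (i + 1)) := by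
  have hlast : entry n (p + 1) = tailSum n (p + 1) := by
    rw [tailSum_eq_entry_add n le_rfl, tailSum_of_lt n (by omega), add_zero]
  have hentry : ∀ i ∈ Finset.range p,
      qBinom ((entry n (i + 1) : ℤ) + 2 * k - 2 * ∑ t ∈ Finset.Icc 1 (i + 1), (tailSum n t : ℤ)
          + min (Δ : ℤ) (((p + 2 : ℕ) : ℤ) - 1 - ((i + 1 : ℕ) : ℤ))) (entry n (i + 1))
      = qBinom (2 * ((k : ℤ) - ∑ t ∈ Finset.range (i + 1), (tailSum n (t + 1) : ℤ))
          + min (Δ : ℤ) (p - i) + tailSum n (i + 1) - tailSum n (i + 1 + 1))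
          (tailSum n (i + 1) - tailSum n (i + 1 + 1)) := by
    intro i hi
    rw [tailSum_eq_entry_add n (show i + 1 ≤ p + 1 by have := Finset.mem_range.mp hi; omega),
      sum_Icc_one_eq_sum_range]
    push_cast
    rw [show (p : ℤ) + 2 - 1 - (i + 1) = p - i by ring]
    congr 1 <;> ring
  have hexp : ∑ t ∈ Finset.Icc (p + 2 - Δ) (p + 1), tailSum n t
      = ∑ i ∈ Finset.range (p + 1), if p < Δ + i then tailSum n (i + 1) else 0 := by
    have h := sum_Icc_one_eq_sum_range (p + 1) fun t => if p + 1 < Δ + t then tailSum n t else 0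
    simp only [← add_assoc, add_lt_add_iff_right] at h
    rw [← h, ← Finset.sum_filter]
    refine Finset.sum_congr ?_ fun _ _ => rfl
    ext t
    simp only [Finset.mem_Icc, Finset.mem_filter]
    omega
  have hexp' : ((∑ t ∈ Finset.Icc (p + 2 - Δ) (p + 1), tailSum n t : ℕ) : ℤ)
      = (∑ i ∈ Finset.range p, if p < Δ + (i + 1) then (tailSum n (i + 1 + 1) : ℤ) else 0)
        + (if p < Δ then 1 else 0) * (tailSum n 1 : ℤ) := by
    rw [hexp, Finset.sum_range_succ']
    push_cast
    simp
  -- The indices `v - 1` and `v - 2` reduce to `p + 1` and `p`.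
  change toLaurent (X ^ ((m + k) ^ 2 + k ^ 2 + Δ * (m + 2 * k)
      + ∑ j ∈ Finset.Icc 1 (p + 1), tailSum n j ^ 2
      + ∑ t ∈ Finset.Icc (p + 2 - Δ) (p + 1), tailSum n t)
    * qTrinom L m (2 * k + Δ)
    * qBinomSq ((k : ℤ) - ∑ t ∈ Finset.Icc 1 p, (tailSum n t : ℤ)) (entry n (p + 1))
    * ∏ j ∈ Finset.Icc 1 p,
        qBinom ((entry n j : ℤ) + 2 * k - 2 * ∑ t ∈ Finset.Icc 1 j, (tailSum n t : ℤ)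
          + min (Δ : ℤ) (((p + 2 : ℕ) : ℤ) - 1 - j)) (entry n j)) = _
  rw [chainWeight_eq, prod_Icc_one_eq_prod_range, Finset.prod_congr rfl hentry, hlast,
    sum_Icc_one_eq_sum_range p, sum_Icc_one_eq_sum_range (p + 1)]
  have e : ((((m + k) ^ 2 + k ^ 2 + Δ * (m + 2 * k)
      + ∑ i ∈ Finset.range (p + 1), tailSum n (i + 1) ^ 2
      + ∑ t ∈ Finset.Icc (p + 2 - Δ) (p + 1), tailSum n t : ℕ)) : ℤ)
      = (((m : ℤ) + k) ^ 2 + k ^ 2 + Δ * (m + 2 * k))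
        + (((tailSum n 1 : ℤ) ^ 2 + (if p < Δ then 1 else 0) * (tailSum n 1 : ℤ))
        + (∑ i ∈ Finset.range p, (tailSum n (i + 1 + 1) : ℤ) ^ 2
          + ∑ i ∈ Finset.range p,
            if p < Δ + (i + 1) then (tailSum n (i + 1 + 1) : ℤ) else 0)) := by
    rw [Nat.cast_add _ (∑ t ∈ Finset.Icc (p + 2 - Δ) (p + 1), tailSum n t), hexp',
      Finset.sum_range_succ']
    push_cast
    ring
  simp only [map_mul, map_prod, toLaurent_X_pow, e, T_add _ (_ + (_ + _)), qTrinom, ← gb.eq_1]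
  rw [T_add (_ + _) (_ + _)]
  ring

theorem extendZero_tailSum {p : ℕ} (n : Fin p → ℕ) :
    extendZero (fun i : Fin p => tailSum n (i + 1)) = fun i => tailSum n (i + 1) := by
  funext i
  unfold extendZero
  split_ifs with h
  · rfl
  · rw [tailSum_of_lt n (by omega)]

theorem exists_tailSum_eq {p : ℕ} {g : Fin p → ℕ}
    (hg : ∀ i, extendZero g (i + 1) ≤ extendZero g i) :
    ∃ n : Fin p → ℕ, (fun i : Fin p => tailSum n (i + 1)) = g := by
  set n : Fin p → ℕ := fun i => extendZero g i - extendZero g (i + 1) with hn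
  have key : ∀ d i, i + d = p → tailSum n (i + 1) = extendZero g i := by
    intro d
    induction d with
    | zero =>
      intro i hi
      rw [tailSum_of_lt n (by omega), extendZero, dif_neg (by omega)]
    | succ d ih =>
      intro i hi
      have h1 := hg i
      have h2 : entry n (i + 1) = extendZero g i - extendZero g (i + 1) :=
        dif_pos (by omega)
      rw [tailSum_eq_entry_add n (by omega), ih (i + 1) (by omega), h2]
      omega
  refine ⟨n, funext fun i => ?_⟩
  rw [key (p - i) i (by omega), extendZero, dif_pos i.isLt]

theorem tailSum_injective (p : ℕ) :
    Function.Injective fun (n : Fin p → ℕ) (i : Fin p) => tailSum n (i + 1) := by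
  intro n n' h
  have h1 := congrArg extendZero h
  simp only [extendZero_tailSum] at h1
  funext i
  have e := congrFun h1 i
  have e' := congrFun h1 (i + 1)
  rw [tailSum_eq_entry_add n (by omega), tailSum_eq_entry_add n' (by omega), e'] at e
  have e2 : entry n (i + 1) = entry n' (i + 1) := by omega
  simpa [entry, Nat.add_one_le_iff] using e2

/-- Summation over all `n_1, n_2, …` is summation over all chains `N_1 ≥ N_2 ≥ ⋯`. -/
theorem finsum_tailSum {p : ℕ} {F : (Fin p → ℕ) → ℤ[T;T⁻¹]}
    (hF : ∀ g, F g ≠ 0 → ∀ i, extendZero g (i + 1) ≤ extendZero g i) :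
    ∑ᶠ n : Fin p → ℕ, F (fun i => tailSum n (i + 1)) = ∑ᶠ g, F g := by
  rw [← finsum_mem_range (f := F) (tailSum_injective p), finsum_mem_def,
    Set.indicator_eq_self.mpr]
  intro g hg
  exact exists_tailSum_eq (hF g hg)

theorem multisumTerm_support_finite {p Δ : ℕ} (hΔ : Δ < p + 2) (L : ℕ) :
    (Function.support fun x : ℕ × ℕ × (Fin (p + 1) → ℕ) =>
      multisumTerm (p + 2) Δ L x.1 x.2.1 x.2.2).Finite := by
  refine ((Set.finite_Iic L).prod ((Set.finite_Iic L).prod (finite_setOf_le L))).subset ?_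
  rintro ⟨m, k, n⟩ h
  have h' : toLaurent (multisumTerm (p + 2) Δ L m k n) ≠ 0 := fun hc =>
    h (toLaurent_eq_zero.mp hc)
  rw [toLaurent_multisumTerm hΔ] at h'
  have h1 := gb_ne_zero (left_ne_zero_of_mul (right_ne_zero_of_mul (left_ne_zero_of_mul h')))
  have h2 := gb_ne_zero (right_ne_zero_of_mul (right_ne_zero_of_mul (left_ne_zero_of_mul h')))
  have h3 := (chainWeight_ne_zero (right_ne_zero_of_mul (right_ne_zero_of_mul h'))).1
  refine ⟨show m ≤ L by omega, show k ≤ L by omega, fun i => show n i ≤ L from ?_⟩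
  have h4 := h3 i (by omega)
  rw [tailSum_eq_entry_add n (by omega)] at h4
  have h5 : entry n (i + 1) = n i := dif_pos (by omega)
  omega

theorem finsum_multisumTerm {p Δ : ℕ} (hΔ : Δ < p + 2) (L m k : ℕ) :
    ∑ᶠ n : Fin (p + 1) → ℕ, toLaurent (multisumTerm (p + 2) Δ L m k n)
      = T (((m : ℤ) + k) ^ 2 + k ^ 2 + Δ * (m + 2 * k)) * (gb L m * gb (L - m) (2 * k + Δ))
        * ∑ᶠ b : ℤ, altSign b * T ((p + 2) * b ^ 2 + Δ * b)
          * gb (2 * k + Δ) (k - (p + 2) * b) := by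
  simp only [toLaurent_multisumTerm hΔ, ← mul_finsum]
  rw [← finsum_mul_chainWeight hΔ, ← finsum_tailSum (F := fun g => T ((extendZero g 0 : ℤ) ^ 2
    + (if p < Δ then 1 else 0) * (extendZero g 0 : ℤ)) * chainWeight Δ p k (extendZero g))]
  · simp only [extendZero_tailSum, zero_add]
  · intro g hg i
    rcases lt_or_ge i p with hi | hi
    · exact (chainWeight_ne_zero (right_ne_zero_of_mul hg)).2 i hi
    · rw [extendZero, dif_neg (by omega)]
      exact Nat.zero_le _

/-! ### The identity -/

/-- The terms of the alternating sum are non-zero only for `k ≥ 0`, as `Δ < v`. -/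
theorem gb_shift_ne_zero {v Δ : ℕ} {k b : ℤ} (hΔ : Δ < v) (h : gb (2 * k + Δ) (k - v * b) ≠ 0) :
    0 ≤ k ∧ -(k + Δ) ≤ b ∧ b ≤ k := by
  have h1 := gb_ne_zero h
  rcases lt_trichotomy b 0 with hb | rfl | hb
  · have : (v : ℤ) * b ≤ -v := by nlinarith
    have : (v : ℤ) * b ≤ b := by nlinarith
    omega
  · omega
  · have : (v : ℤ) ≤ v * b := by nlinarith
    have : b ≤ (v : ℤ) * b := by nlinarith
    omega

/-- The identity of the theorem with `v = p + 2`: the sum over the `n_j` is inserted, and the sums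
over `m` and `k` are carried out for each `b` by `gb_trinomial_transform`. -/
theorem toLaurent_finsum_multisumTerm {p Δ : ℕ} (hΔ : Δ < p + 2) (L : ℕ) :
    toLaurent (∑ᶠ x : ℕ × ℕ × (Fin (p + 1) → ℕ), multisumTerm (p + 2) Δ L x.1 x.2.1 x.2.2)
      = ∑ᶠ b : ℤ, altSign b * T ((2 * (p + 2) + 1) * ((p + 2) * b ^ 2 + Δ * b))
        * gb (2 * L) (L - Δ - 2 * (p + 2) * b) := by
  set J : ℤ → ℤ → ℤ → ℤ[T;T⁻¹] := fun m k b =>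
    T ((m + k) ^ 2 + k ^ 2 + Δ * (m + 2 * k)) * (gb L m * gb (L - m) (2 * k + Δ))
      * (altSign b * T ((p + 2) * b ^ 2 + Δ * b) * gb (2 * k + Δ) (k - (p + 2) * b)) with hJ
  have hJ0 : ∀ m k b, J m k b ≠ 0 →
      (0 ≤ m ∧ m ≤ L) ∧ (0 ≤ k ∧ k ≤ L) ∧ -(L + Δ) ≤ b ∧ b ≤ L := by
    intro m k b h
    have h1 := gb_ne_zero (left_ne_zero_of_mul (right_ne_zero_of_mul (left_ne_zero_of_mul h)))
    have h2 := gb_ne_zero (right_ne_zero_of_mul (right_ne_zero_of_mul (left_ne_zero_of_mul h)))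
    have h3 := right_ne_zero_of_mul (right_ne_zero_of_mul h)
    have h4 := gb_shift_ne_zero (v := p + 2) hΔ (by push_cast; exact h3)
    omega
  have hfin := multisumTerm_support_finite hΔ L
  have hfin' : (Function.support fun x : ℕ × ℕ × (Fin (p + 1) → ℕ) =>
      toLaurent (multisumTerm (p + 2) Δ L x.1 x.2.1 x.2.2)).Finite :=
    hfin.subset fun x hx h => hx (by simp only [h, map_zero])
  rw [map_finsum _ hfin, finsum_curry₃ _ hfin']
  simp only [finsum_multisumTerm hΔ, mul_finsum]
  have hN : ∑ᶠ (m : ℕ) (k : ℕ) (b : ℤ), J m k b = ∑ᶠ (m : ℤ) (k : ℤ) (b : ℤ), J m k b := by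
    rw [← finsum_natCast]
    · refine finsum_congr fun m =>
        finsum_natCast (f := fun k => ∑ᶠ b, J m k b) fun k hk => ?_
      refine finsum_eq_zero_of_forall_eq_zero fun b => ?_
      by_contra h
      have := hJ0 _ _ _ h
      omega
    · intro m hm
      refine finsum_eq_zero_of_forall_eq_zero fun k => finsum_eq_zero_of_forall_eq_zero fun b => ?_
      by_contra h
      have := hJ0 _ _ _ h
      omega
  refine hN.trans ?_
  have hswap : ∀ m, ∑ᶠ (k : ℤ) (b : ℤ), J m k b = ∑ᶠ (b : ℤ) (k : ℤ), J m k b := fun m =>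
    finsum_comm_int (-(L + Δ)) L fun k b h => by
      have := hJ0 _ _ _ h
      omega
  rw [finsum_congr hswap, finsum_comm_int (-(L + Δ)) L]
  · refine finsum_congr fun b => ?_
    have key := gb_trinomial_transform (L := L) (by omega) (Δ + 2 * ((p + 2) * b))
    rw [show (L : ℤ) - Δ - 2 * (p + 2) * b = L - (Δ + 2 * ((p + 2) * b)) by ring, ← key, mul_finsum]
    refine finsum_congr fun m => ?_
    -- The index `k` is `q + v b`, which makes the lower entry `k - v b` equal to `q`.
    rw [mul_finsum, ← finsum_comp_equiv (Equiv.addRight ((p + 2) * b : ℤ))]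
    refine finsum_congr fun q => ?_
    simp only [hJ, Equiv.coe_addRight]
    rw [add_sub_cancel_right, show 2 * (q + ((p : ℤ) + 2) * b) + Δ
      = 2 * q + (Δ + 2 * ((p + 2) * b)) by ring]
    have e : (T ((m + (q + ((p : ℤ) + 2) * b)) ^ 2 + (q + ((p : ℤ) + 2) * b) ^ 2
          + Δ * (m + 2 * (q + ((p : ℤ) + 2) * b))) * T (((p : ℤ) + 2) * b ^ 2 + Δ * b) : ℤ[T;T⁻¹])
        = T ((2 * ((p : ℤ) + 2) + 1) * (((p : ℤ) + 2) * b ^ 2 + Δ * b))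
          * T (m ^ 2 + m * (2 * q + (Δ + 2 * (((p : ℤ) + 2) * b)))
            + 2 * q * (q + (Δ + 2 * (((p : ℤ) + 2) * b)))) := by
      rw [← T_add, ← T_add]; congr 1; ring
    linear_combination altSign b * gb L m * gb (L - m) (2 * q + (Δ + 2 * ((p + 2) * b)))
      * gb (2 * q + (Δ + 2 * ((p + 2) * b))) q * e
  · intro m b h
    obtain ⟨k, hk⟩ : ∃ k, J m k b ≠ 0 := by
      by_contra! hc
      exact h (finsum_eq_zero_of_forall_eq_zero hc)
    have := hJ0 _ _ _ hk
    omega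

/-! ### Non-negative coefficients -/

theorem NonnegCoeffs.add {P Q : ℤ[X]} (hP : NonnegCoeffs P) (hQ : NonnegCoeffs Q) :
    NonnegCoeffs (P + Q) := fun i => by
  rw [coeff_add]
  exact add_nonneg (hP i) (hQ i)

theorem NonnegCoeffs.mul {P Q : ℤ[X]} (hP : NonnegCoeffs P) (hQ : NonnegCoeffs Q) :
    NonnegCoeffs (P * Q) := fun i => by
  rw [coeff_mul]
  exact Finset.sum_nonneg fun x _ => mul_nonneg (hP _) (hQ _)

theorem nonnegCoeffs_X_pow (n : ℕ) : NonnegCoeffs (X ^ n) := fun i => by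
  rw [coeff_X_pow]
  split_ifs <;> simp

theorem nonnegCoeffs_zero : NonnegCoeffs 0 := fun i => by simp

theorem nonnegCoeffs_one : NonnegCoeffs 1 := by simpa using nonnegCoeffs_X_pow 0

theorem NonnegCoeffs.comp_X_sq {P : ℤ[X]} (hP : NonnegCoeffs P) :
    NonnegCoeffs (P.comp (X ^ 2)) := fun i => by
  rw [← expand_eq_comp_X_pow, coeff_expand two_pos]
  split_ifs
  · exact hP _
  · exact le_rfl

theorem nonnegCoeffs_gaussBinom (n k : ℕ) : NonnegCoeffs (gaussBinom n k) := by
  induction n generalizing k with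
  | zero =>
    cases k
    · exact nonnegCoeffs_one
    · exact nonnegCoeffs_zero
  | succ n ih =>
    cases k with
    | zero => exact nonnegCoeffs_one
    | succ k => exact (ih k).add ((nonnegCoeffs_X_pow _).mul (ih (k + 1)))

theorem nonnegCoeffs_qBinom (a b : ℤ) : NonnegCoeffs (qBinom a b) := by
  unfold qBinom
  split_ifs
  · exact nonnegCoeffs_gaussBinom _ _
  · exact nonnegCoeffs_zero

theorem nonnegCoeffs_qTrinom (a m n : ℤ) : NonnegCoeffs (qTrinom a m n) :=
  (nonnegCoeffs_qBinom _ _).mul (nonnegCoeffs_qBinom _ _)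

theorem nonnegCoeffs_multisumTerm (v Δ L m k : ℕ) (n : Fin (v - 1) → ℕ) :
    NonnegCoeffs (multisumTerm v Δ L m k n) := by
  refine (((nonnegCoeffs_X_pow _).mul (nonnegCoeffs_qTrinom _ _ _)).mul
    (nonnegCoeffs_qBinom _ _).comp_X_sq).mul ?_
  exact Finset.prod_induction _ NonnegCoeffs (fun _ _ => NonnegCoeffs.mul) nonnegCoeffs_one
    fun _ _ => nonnegCoeffs_qBinom _ _

theorem ofPoly_X_pow (n : ℕ) : ofPoly (X ^ n) = qPow n := by
  rw [ofPoly, map_pow, aeval_X, qPow, AddMonoidAlgebra.single_pow, one_pow, nsmul_one, qPow]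

end QSeries

theorem theoremT1p1 (v Δ L : ℕ) (hv : 2 ≤ v) (hΔ : Δ < v) :
    -- both sums have only finitely many non-zero terms
    (Function.support fun x : ℕ × ℕ × (Fin (v - 1) → ℕ) =>
      multisumTerm v Δ L x.1 x.2.1 x.2.2).Finite ∧
    {j : ℤ | qBinom (2 * L) (L - Δ - 2 * v * j) ≠ 0}.Finite ∧
    -- the identity, in the ring of Laurent polynomials in `q = T 1`
    toLaurent (∑ᶠ x : ℕ × ℕ × (Fin (v - 1) → ℕ), multisumTerm v Δ L x.1 x.2.1 x.2.2) =
      ∑ᶠ j : ℤ, (j.negOnePow : ℤ) •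
        ((T ((2 * v + 1) * v * j ^ 2 + (2 * v + 1) * Δ * j) : ℤ[T;T⁻¹])
          * toLaurent (qBinom (2 * L) (L - Δ - 2 * v * j))) ∧
    -- the `q`-trinomial coefficients have non-negative coefficients
    (∀ a m n : ℤ, NonnegCoeffs (qTrinom a m n)) ∧
    -- the positivity result
    ∃ P : ℤ[X], NonnegCoeffs P ∧
      bressoudG ((L : ℤ) - Δ) ((L : ℤ) + Δ)
        (((v : ℚ) + Δ) * (1 + 1 / (2 * v))) (((v : ℚ) - Δ) * (1 + 1 / (2 * v))) (2 * v) =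
      ofPoly P := by
  have hfin : {j : ℤ | qBinom (2 * L) (L - Δ - 2 * v * j) ≠ 0}.Finite := by
    have h := qBinom_support_finite ((L : ℤ) - Δ) ((L : ℤ) + Δ) (2 * v) (by omega)
    push_cast at h
    rwa [show (L : ℤ) - Δ + (L + Δ) = 2 * L by ring] at h
  have hid : toLaurent (∑ᶠ x : ℕ × ℕ × (Fin (v - 1) → ℕ), multisumTerm v Δ L x.1 x.2.1 x.2.2) =
      ∑ᶠ j : ℤ, (j.negOnePow : ℤ) •
        ((T ((2 * v + 1) * v * j ^ 2 + (2 * v + 1) * Δ * j) : ℤ[T;T⁻¹])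
          * toLaurent (qBinom (2 * L) (L - Δ - 2 * v * j))) := by
    obtain ⟨p, rfl⟩ : ∃ p, v = p + 2 := ⟨v - 2, by omega⟩
    refine (toLaurent_finsum_multisumTerm hΔ L).trans (finsum_congr fun b => ?_)
    rw [zsmul_eq_mul, altSign, gb, mul_assoc]
    push_cast
    congr 3
    ring
  -- The exponents are natural numbers, so the identity can be read in `ℤ[X]` and then carried over
  -- to the ring of rational powers.
  have hexp : ∀ j : ℤ, 0 ≤ (2 * v + 1) * v * j ^ 2 + (2 * v + 1) * Δ * j := by
    intro j
    have h1 : 0 ≤ (v : ℤ) * j ^ 2 + Δ * j := by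
      rcases le_or_gt 0 j with hj | hj
      · positivity
      · have h2 : (Δ : ℤ) ≤ v := by omega
        nlinarith [mul_nonneg (sub_nonneg.mpr h2) (by omega : 0 ≤ -j),
          mul_nonneg (by omega : (0 : ℤ) ≤ v)
            (mul_nonneg (by omega : 0 ≤ -j) (by omega : 0 ≤ -j - 1))]
    rw [show (2 * (v : ℤ) + 1) * v * j ^ 2 + (2 * v + 1) * Δ * j
      = (2 * v + 1) * (v * j ^ 2 + Δ * j) by ring]
    exact mul_nonneg (by omega) h1
  set f : ℤ → ℤ[X] := fun j => (j.negOnePow : ℤ) •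
    (X ^ ((2 * v + 1) * v * j ^ 2 + (2 * v + 1) * Δ * j : ℤ).toNat
      * qBinom (2 * L) (L - Δ - 2 * v * j)) with hf
  have hffin : (Function.support f).Finite := hfin.subset fun j hj h => hj (by simp [hf, h])
  have hpoly : ∑ᶠ x : ℕ × ℕ × (Fin (v - 1) → ℕ), multisumTerm v Δ L x.1 x.2.1 x.2.2
      = ∑ᶠ j, f j := by
    apply toLaurent_injective
    rw [hid, map_finsum _ hffin]
    refine finsum_congr fun j => ?_
    simp only [hf]
    rw [map_zsmul, map_mul, toLaurent_X_pow, Int.toNat_of_nonneg (hexp j)]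
  refine ⟨?_, hfin, hid, nonnegCoeffs_qTrinom,
    ∑ᶠ x : ℕ × ℕ × (Fin (v - 1) → ℕ), multisumTerm v Δ L x.1 x.2.1 x.2.2, ?_, ?_⟩
  · obtain ⟨p, rfl⟩ : ∃ p, v = p + 2 := ⟨v - 2, by omega⟩
    exact multisumTerm_support_finite hΔ L
  · exact finsum_induction NonnegCoeffs nonnegCoeffs_zero (fun _ _ => NonnegCoeffs.add)
      fun x => nonnegCoeffs_multisumTerm _ _ _ _ _ _
  · rw [hpoly, map_finsum _ hffin, bressoudG]
    refine finsum_congr fun j => ?_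
    have hv0 : (v : ℚ) ≠ 0 := by
      have : v ≠ 0 := by omega
      exact_mod_cast this
    simp only [hf, bressoudTerm]
    rw [map_zsmul, map_mul, ofPoly_X_pow]
    have e : ((((2 * v + 1) * v * j ^ 2 + (2 * v + 1) * Δ * j : ℤ).toNat : ℕ) : ℚ)
        = ((2 * v : ℕ) : ℚ) * j * (((((v : ℚ) + Δ) * (1 + 1 / (2 * v))
          + ((v : ℚ) - Δ) * (1 + 1 / (2 * v))) * j
          + (((v : ℚ) + Δ) * (1 + 1 / (2 * v)) - ((v : ℚ) - Δ) * (1 + 1 / (2 * v)))) / 2) := by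
      rw [← Int.cast_natCast, Int.toNat_of_nonneg (hexp j)]
      push_cast
      field_simp
      ring
    rw [e]
    push_cast
    rw [show (L : ℤ) - Δ + (L + Δ) = 2 * L by ring]
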